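/- Let $n_1,n_2\ge 1$ and $k_1,k_2\ge 0$ be integers, put $m_i=n_i+k_i$, and let $\Omega\subseteq\{0,\dots,m_1-1\}\times\{0,\dots,m_2-1\}$ be a known block of $n_1$ consecutive rows and $n_2$ consecutive columns. For a signal $X\in\mathbb{R}^{n_1\times n_2}$ and a background $Y\in\mathbb{R}^{m_1\times m_2}$ let $Z=Z(X,Y)\in\mathbb{R}^{m_1\times m_2}$ be the array that equals $X$ on $\Omega$ (after translating indices) and equals $Y$ off $\Omega$. For $Z\in\mathbb{R}^{m_1\times m_2}$ let $I(Z)=\left|F_{m_1}^{\mathrm H}\,Z\,F_{m_2}^{\mathrm H}\right|^2\in\mathbb{R}^{m_1\times m_2}$ (entrywise squared modulus), where $F_m=(e^{2\pi \mathrm{i}jl/m})_{0\le j,l<m}$. Suppose that the entries $Y_{i,h}$, $(i,h)\notin\Omega$, are independent $\mathcal N(\mu,\sigma^2)$ random variables with $\mu\in\mathbb{R}$ and $\sigma>0$. If $$(n_1+k_1)(n_2+k_2)\ \ge\ (2n_1-1)(3n_2-1)+n_2,$$ then, almost surely, the following holds for every $X\in\mathbb{R}^{n_1\times n_2}$: the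 problem of finding a $Z'\in\mathbb{R}^{m_1\times m_2}$ with $I(Z')=I(Z(X,Y))$ and $Z'=Z(X',Y)$ for some $X'\in\mathbb{R}^{n_1\times n_2}$ has exactly one solution, namely $Z'=Z(X,Y)$, and the only $X'\in\mathbb{R}^{n_1\times n_2}$ with $I(Z(X',Y))=I(Z(X,Y))$ is $X'=X$ (so there are no ambiguities, not even trivial ones). In particular, when $n_1=n_2=n$ and $k_1=k_2=k$, the condition $k\ge(\sqrt6-1)\,n$ is sufficient for the same conclusion. -/

import Mathlib

open MeasureTheory ProbabilityTheory Matrix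

namespace PhaseRetrieval

/-- The `m × m` Fourier matrix, with entries `exp (2πi j l / m)` for `0 ≤ j, l < m`. -/
noncomputable def fourierMatrix (m : ℕ) : Matrix (Fin m) (Fin m) ℂ :=
  Matrix.of fun j l =>
    Complex.exp (2 * (Real.pi : ℂ) * Complex.I * ((j : ℕ) : ℂ) * ((l : ℕ) : ℂ) / (m : ℂ))

/-- The phaseless measurements without oversampling: the entrywise squared modulus
of `Fᴴ Z Fᴴ`, where the two factors are the full Fourier matrices of sizes `m₁` and `m₂`. -/
noncomputable def intensity {m₁ m₂ : ℕ} (Z : Matrix (Fin m₁) (Fin m₂) ℝ) :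
    Matrix (Fin m₁) (Fin m₂) ℝ :=
  Matrix.of fun p q =>
    ‖((fourierMatrix m₁)ᴴ * Z.map (fun x : ℝ => (x : ℂ)) * (fourierMatrix m₂)ᴴ) p q‖ ^ 2

/-- The known region occupied by the signal: the `n₁ × n₂` block of the
`(n₁ + k₁) × (n₂ + k₂)` array whose first entry sits at position `(a₁, a₂)`. -/
def region (n₁ n₂ k₁ k₂ a₁ a₂ : ℕ) : Set (Fin (n₁ + k₁) × Fin (n₂ + k₂)) :=
  {p | (a₁ ≤ (p.1 : ℕ) ∧ (p.1 : ℕ) < a₁ + n₁) ∧ (a₂ ≤ (p.2 : ℕ) ∧ (p.2 : ℕ) < a₂ + n₂)}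

open Classical in
/-- The combined array `Z`: the signal `X` on the region, the background `Y` elsewhere
(the entries of `Y` on the region play no role). -/
noncomputable def combine {n₁ n₂ k₁ k₂ : ℕ} (a₁ a₂ : ℕ) (X : Matrix (Fin n₁) (Fin n₂) ℝ)
    (Y : Matrix (Fin (n₁ + k₁)) (Fin (n₂ + k₂)) ℝ) :
    Matrix (Fin (n₁ + k₁)) (Fin (n₂ + k₂)) ℝ :=
  Matrix.of fun i h =>
    if hp : (i, h) ∈ region n₁ n₂ k₁ k₂ a₁ a₂ then
      X ⟨(i : ℕ) - a₁, Nat.sub_lt_left_of_lt_add hp.1.1 hp.1.2⟩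
        ⟨(h : ℕ) - a₂, Nat.sub_lt_left_of_lt_add hp.2.1 hp.2.2⟩
    else Y i h

/-- `Z` solves the phase retrieval problem with background information `Y` and data `I`. -/
def IsSolution {n₁ n₂ k₁ k₂ : ℕ} (a₁ a₂ : ℕ)
    (I Y Z : Matrix (Fin (n₁ + k₁)) (Fin (n₂ + k₂)) ℝ) : Prop :=
  intensity Z = I ∧ ∃ X : Matrix (Fin n₁) (Fin n₂) ℝ, Z = combine a₁ a₂ X Y

/-- Exact uniqueness for the background `Y`, with no ambiguity of any kind: whatever the real
signal `X`, the problem with the data generated by `X` has the true array as its one and only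
solution, and `X` is the one and only signal that gives these data. -/
def ExactlyUnique {n₁ n₂ k₁ k₂ : ℕ} (a₁ a₂ : ℕ)
    (Y : Matrix (Fin (n₁ + k₁)) (Fin (n₂ + k₂)) ℝ) : Prop :=
  ∀ X : Matrix (Fin n₁) (Fin n₂) ℝ,
    (∀ Z, IsSolution a₁ a₂ (intensity (combine a₁ a₂ X Y)) Y Z ↔ Z = combine a₁ a₂ X Y) ∧
    ∀ X' : Matrix (Fin n₁) (Fin n₂) ℝ,
      intensity (combine a₁ a₂ X' Y) = intensity (combine a₁ a₂ X Y) → X' = X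

/-- The entries of the random background outside the signal's region are independent
`N(μ, σ²)` random variables. -/
structure IsGaussianBackground {Ω : Type*} [MeasurableSpace Ω] (P : Measure Ω) (μ σ : ℝ)
    {n₁ n₂ k₁ k₂ : ℕ} (a₁ a₂ : ℕ)
    (Y : Ω → Matrix (Fin (n₁ + k₁)) (Fin (n₂ + k₂)) ℝ) : Prop where
  hasLaw : ∀ p ∉ region n₁ n₂ k₁ k₂ a₁ a₂,
    HasLaw (fun ω => Y ω p.1 p.2) (gaussianReal μ ⟨σ ^ 2, sq_nonneg σ⟩) P
  indep : iIndepFun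
    (fun (p : {p : Fin (n₁ + k₁) × Fin (n₂ + k₂) // p ∉ region n₁ n₂ k₁ k₂ a₁ a₂}) (ω : Ω) =>
      Y ω p.1.1 p.1.2) P

end PhaseRetrieval

namespace PhaseRetrieval

/-! The intensities determine the cyclic autocorrelation of the array. At a shift `p` in
`farShifts`, no two block positions differ by `p`, so no product of two signal entries occurs and
the autocorrelation is affine in the signal. The difference `W` of two signals with the same data
therefore satisfies the linear equations `∑ W j * (y (j + p) + y (j - p)) = 0`, where `y` is the
background (`sum_mul_periodicExtension_eq_zero`).

It remains to see that almost every background makes this system injective. Injectivity is the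
nonvanishing of a Gram determinant, a polynomial in the background. Once one good background exists
the polynomial is nonzero, and its zero set is null for a product of nondegenerate Gaussians
(`exists_polynomial_isDetermining`, `ae_eval_ne_zero`).

A good background is a sum of point masses of generic sizes (`Recovers.peel`, `recovers_farShifts`).
Each mass isolates some unknowns, one equation per unknown, and is invisible to the equations kept
for the others. Since `p` and `-p` give the same equation, about half of the far shifts are
available. When `mᵢ ≥ 2nᵢ - 1`, there are `m₁m₂ - (2n₁-1)(2n₂-1)` far shifts, and the hypothesis
says exactly that this is at least `2n₁n₂`: at least as many equations, up to sign, as unknowns. -/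

/-! ### Recovery on the torus and the peeling step. -/

/-- Congruence of integer positions on the `m₁ × m₂` torus. -/
def TorusCongr (m₁ m₂ : ℤ) (a b : ℤ × ℤ) : Prop :=
  m₁ ∣ a.1 - b.1 ∧ m₂ ∣ a.2 - b.2

/-- Some background on the `m₁ × m₂` torus makes the equations
`∑ d ∈ A, D d * (y (d + p) + y (d - p)) = 0`, `p ∈ R`, force `D` to vanish on `A`. -/
def Recovers (m₁ m₂ : ℤ) (R : Set (ℤ × ℤ)) (A : Finset (ℤ × ℤ)) : Prop :=
  ∃ y : ℤ × ℤ → ℝ, (∀ a b, TorusCongr m₁ m₂ a b → y a = y b) ∧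
    ∀ D : ℤ × ℤ → ℝ, (∀ p ∈ R, ∑ d ∈ A, D d * (y (d + p) + y (d - p)) = 0) → ∀ d ∈ A, D d = 0

theorem TorusCongr.swap {m₁ m₂ : ℤ} {a b : ℤ × ℤ} (h : TorusCongr m₁ m₂ a b) :
    TorusCongr m₂ m₁ a.swap b.swap := ⟨h.2, h.1⟩

theorem TorusCongr.trans_iff {m₁ m₂ : ℤ} {a b s : ℤ × ℤ} (h : TorusCongr m₁ m₂ a b) :
    TorusCongr m₁ m₂ a s ↔ TorusCongr m₁ m₂ b s := by
  obtain ⟨h1, h2⟩ := h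
  unfold TorusCongr
  rw [show a.1 - s.1 = (a.1 - b.1) + (b.1 - s.1) by ring,
    show a.2 - s.2 = (a.2 - b.2) + (b.2 - s.2) by ring,
    (Int.dvd_add_right h1), (Int.dvd_add_right h2)]

theorem Recovers.mono {m₁ m₂ : ℤ} {R R' : Set (ℤ × ℤ)} {A : Finset (ℤ × ℤ)} (hR : R' ⊆ R)
    (h : Recovers m₁ m₂ R' A) : Recovers m₁ m₂ R A := by
  obtain ⟨y, hy, h⟩ := h
  exact ⟨y, hy, fun D hD => h D fun p hp => hD p (hR hp)⟩

theorem Recovers.of_empty (m₁ m₂ : ℤ) (R : Set (ℤ × ℤ)) : Recovers m₁ m₂ R ∅ :=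
  ⟨0, fun _ _ _ => rfl, fun _ _ d hd => absurd hd (Finset.notMem_empty d)⟩

theorem Recovers.swap {m₁ m₂ : ℤ} {R : Set (ℤ × ℤ)} {A : Finset (ℤ × ℤ)}
    (h : Recovers m₁ m₂ R A) :
    Recovers m₂ m₁ (Prod.swap ⁻¹' R) (A.map (Equiv.prodComm ℤ ℤ).toEmbedding) := by
  obtain ⟨y, hy, h⟩ := h
  refine ⟨y ∘ Prod.swap, fun a b hab => hy _ _ hab.swap, fun D hD d hd => ?_⟩
  obtain ⟨d', hd', rfl⟩ := Finset.mem_map.1 hd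
  refine h (D ∘ Prod.swap) (fun p hp => ?_) d' hd'
  have := hD p.swap (by simpa using hp)
  rw [Finset.sum_map] at this
  simpa using this

open Classical in
/-- Adding a large multiple of a point mass at `s` to the background recovers the entries of
`A \ A'` separately, provided that the equations in `R'` do not see `A` through `s`. -/
theorem Recovers.peel {m₁ m₂ : ℤ} {R R' : Set (ℤ × ℤ)} {A A' : Finset (ℤ × ℤ)} (s : ℤ × ℤ)
    (hR : R' ⊆ R) (hA : A' ⊆ A)
    (hunseen : ∀ p ∈ R', ∀ d ∈ A, ¬ TorusCongr m₁ m₂ (d + p) s ∧ ¬ TorusCongr m₁ m₂ (d - p) s)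
    (hseen : ∀ d ∈ A, d ∉ A' → ∃ p ∈ R, TorusCongr m₁ m₂ (d + p) s ∧
      ∀ d' ∈ A, d' ≠ d → ¬ TorusCongr m₁ m₂ (d' + p) s ∧ ¬ TorusCongr m₁ m₂ (d' - p) s)
    (h : Recovers m₁ m₂ R' A') : Recovers m₁ m₂ R A := by
  obtain ⟨y', hy', h⟩ := h
  choose! φ hφR hφs hφu using hseen
  let δ : ℤ × ℤ → ℝ := fun x => if TorusCongr m₁ m₂ x s then 1 else 0
  -- The second term is nonzero exactly when `2 φ d` vanishes on the torus, so the coefficient is 1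
  -- or 2.
  let c : ℤ × ℤ → ℝ := fun d => δ (d + φ d) + δ (d - φ d)
  let row : ℤ × ℤ → (A → ℝ) →ₗ[ℝ] ℝ := fun p =>
    ∑ d : A, (y' (d + p) + y' (d - p)) • LinearMap.proj d
  have row_apply : ∀ p (D : ℤ × ℤ → ℝ),
      row p (fun d : A => D d) = ∑ d ∈ A, D d * (y' (d + p) + y' (d - p)) := by
    intro p D
    rw [← Finset.sum_coe_sort A]
    simp [row, mul_comm]
  -- `Φ` collects the equations in `R'`, which do not see `s`, and the coefficients of the mass in
  -- the equations `φ d`; `N` collects what `y'` contributes to the latter.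
  let Φ : (A → ℝ) →ₗ[ℝ] (R' → ℝ) × (A → ℝ) :=
    (LinearMap.pi fun p : R' => row p).prod
      (LinearMap.pi fun d : A => (if (d : ℤ × ℤ) ∈ A' then 0 else c d) • LinearMap.proj d)
  let N : (A → ℝ) →ₗ[ℝ] (R' → ℝ) × (A → ℝ) :=
    (0 : (A → ℝ) →ₗ[ℝ] (R' → ℝ)).prod
      (LinearMap.pi fun d : A => if (d : ℤ × ℤ) ∈ A' then 0 else row (φ d))
  have hc : ∀ d ∈ A, d ∉ A' → c d ≠ 0 := by
    intro d hd hd'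
    have h1 : δ (d + φ d) = 1 := if_pos (hφs d hd hd')
    have h2 : 0 ≤ δ (d - φ d) := by simp only [δ]; split_ifs <;> norm_num
    simp only [c, h1]
    positivity
  have hΦ : LinearMap.ker Φ = ⊥ := by
    rw [LinearMap.ker_eq_bot']
    intro E hE
    obtain ⟨hE1, hE2⟩ := Prod.ext_iff.1 hE
    let D : ℤ × ℤ → ℝ := fun d => if hd : d ∈ A then E ⟨d, hd⟩ else 0
    have hDE : E = fun d : A => D d := by funext d; simp [D]
    have hD0 : ∀ d ∈ A, d ∉ A' → D d = 0 := by
      intro d hd hd'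
      have h0 : (if d ∈ A' then 0 else c d) * E ⟨d, hd⟩ = 0 := congrFun hE2 ⟨d, hd⟩
      rw [if_neg hd', mul_eq_zero, or_iff_right (hc d hd hd')] at h0
      simpa [D, hd] using h0
    have hDA : ∀ d ∈ A', D d = 0 := by
      refine h D fun p hp => ?_
      have h0 : row p E = 0 := congrFun hE1 ⟨p, hp⟩
      rw [hDE, row_apply] at h0
      rw [← h0]
      refine Finset.sum_subset hA fun d hd hd' => ?_
      rw [hD0 d hd hd', zero_mul]
    rw [hDE]
    funext d
    by_cases hd : (d : ℤ × ℤ) ∈ A'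
    · exact hDA _ hd
    · exact hD0 _ d.2 hd
  obtain ⟨Ψ, hΨ⟩ := Φ.exists_leftInverse_of_injective hΦ
  -- For the background `y' - μ δ` every solution satisfies `N D = μ Φ D`, hence `Ψ N D = μ D`. Any
  -- `μ` outside the finite spectrum of `Ψ ∘ N` forces `D = 0`.
  obtain ⟨μ, hμ⟩ := (Module.End.finite_hasEigenvalue (Ψ ∘ₗ N)).infinite_compl.nonempty
  refine ⟨fun x => -μ * δ x + y' x, fun a b hab => ?_, fun D hD => ?_⟩
  · simp only [δ, hab.trans_iff, hy' a b hab]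
  have key : N (fun d : A => D d) = μ • Φ (fun d : A => D d) := by
    refine Prod.ext ?_ ?_
    · funext p
      have hp := hD p (hR p.2)
      have : row p (fun d : A => D d) = 0 := by
        rw [row_apply, ← hp]
        refine Finset.sum_congr rfl fun d hd => ?_
        obtain ⟨h1, h2⟩ := hunseen p p.2 d hd
        simp [δ, h1, h2]
      simp [N, Φ, this]
    · funext d
      by_cases hd : (d : ℤ × ℤ) ∈ A'
      · simp [N, Φ, hd]
      have hp := hD (φ d) (hφR d d.2 hd)
      have : ∑ x ∈ A, D x * (-μ * δ (x + φ d) + y' (x + φ d) + (-μ * δ (x - φ d) + y' (x - φ d)))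
          = row (φ d) (fun d : A => D d) - μ * (c d * D d) := by
        rw [row_apply, ← Finset.sum_erase_add _ _ d.2, ← Finset.sum_erase_add A _ d.2]
        have : ∀ x ∈ A.erase d,
            D x * (-μ * δ (x + φ d) + y' (x + φ d) + (-μ * δ (x - φ d) + y' (x - φ d)))
              = D x * (y' (x + φ d) + y' (x - φ d)) := by
          intro x hx
          obtain ⟨hxd, hxA⟩ := Finset.mem_erase.1 hx
          obtain ⟨h1, h2⟩ := hφu d d.2 hd x hxA hxd
          simp [δ, h1, h2]
        rw [Finset.sum_congr rfl this]
        simp only [c]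
        ring
      rw [this, sub_eq_zero] at hp
      simpa [N, Φ, hd] using hp
  have hev : (Ψ ∘ₗ N) (fun d : A => D d) = μ • (fun d : A => D d) := by
    rw [LinearMap.comp_apply, key, map_smul, ← LinearMap.comp_apply, hΨ, LinearMap.id_apply]
  have hzero : (fun d : A => D d) = 0 := by
    by_contra hne
    exact hμ (Module.End.hasEigenvalue_of_hasEigenvector ⟨Module.End.mem_eigenspace_iff.2 hev, hne⟩)
  intro d hd
  exact congrFun hzero ⟨d, hd⟩

/-- Turns torus congruences between bounded positions into linear cases for `omega`. -/
theorem eq_of_dvd_of_lt_three_mul {m t : ℤ} (h : m ∣ t) (h1 : -(3 * m) < t) (h2 : t < 3 * m) :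
    t = -2 * m ∨ t = -m ∨ t = 0 ∨ t = m ∨ t = 2 * m := by
  obtain ⟨u, rfl⟩ := h
  have hm : 0 < m := by omega
  have hu1 : -3 < u := by nlinarith
  have hu2 : u < 3 := by nlinarith
  interval_cases u <;> omega

/-! ### Peeling columns with the shifts whose second coordinate is at least `m₂ / 2`. -/

/-- The columns `< k` filled up to height `e₀`, and the column `k` filled up to height `e`. -/
noncomputable def staircase (n₁ n₂ e₀ k e : ℤ) : Finset (ℤ × ℤ) :=
  (Finset.Ico 0 n₁ ×ˢ Finset.Ico 0 n₂).filter fun d => d.2 < k ∧ d.1 < e₀ ∨ d.2 = k ∧ d.1 < e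

theorem mem_staircase {n₁ n₂ e₀ k e : ℤ} {d : ℤ × ℤ} : d ∈ staircase n₁ n₂ e₀ k e ↔
    ((0 ≤ d.1 ∧ d.1 < n₁) ∧ 0 ≤ d.2 ∧ d.2 < n₂) ∧ (d.2 < k ∧ d.1 < e₀ ∨ d.2 = k ∧ d.1 < e) := by
  simp [staircase]

/-- Differences in the self-inverse row `m₂ / 2`, up to sign, from `x` on. -/
def middleShifts (m₁ m₂ x : ℤ) : Set (ℤ × ℤ) :=
  {p | 2 * p.2 = m₂ ∧ x ≤ p.1 ∧ 2 * p.1 ≤ m₁}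

/-- Differences, up to sign, in the rows between `m₂ / 2` and `q`, and from `x` on in the
row `q`. -/
def upperShifts (m₁ m₂ q x : ℤ) : Set (ℤ × ℤ) :=
  {p | p.2 = q ∧ x ≤ p.1 ∧ p.1 < m₁} ∪ {p | m₂ < 2 * p.2 ∧ p.2 < q ∧ 0 ≤ p.1 ∧ p.1 < m₁} ∪
    middleShifts m₁ m₂ 0

/-- Here `p` and `-p` lie in the same row, so only the `m₁ / 2 + 1` shifts up to sign count. Each
mass removes a whole column of unknowns. The restriction `2 * p.1 ≤ m₁` ensures that `d - p` meets
the mass only when `d + p` does. -/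
theorem recovers_middleShifts {m₁ m₂ n₁ n₂ e₀ : ℤ} (hn₁ : n₁ ≤ m₁) (hn₂ : 2 * n₂ ≤ m₂)
    (he₀ : 0 ≤ e₀) (he₀n : e₀ ≤ n₁) (q : ℤ) (hq : 2 * q = m₂) (k : ℕ) :
    ∀ e x : ℤ, (k : ℤ) < n₂ → 0 ≤ e → e ≤ n₁ → 0 ≤ x → e + k * e₀ + x ≤ m₁ / 2 + 1 →
      Recovers m₁ m₂ (middleShifts m₁ m₂ x) (staircase n₁ n₂ e₀ k e) := by
  have step : ∀ k e x : ℤ, 0 ≤ k → k < n₂ → 0 ≤ e → e ≤ n₁ → 0 ≤ x → e + x ≤ m₁ / 2 + 1 →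
      Recovers m₁ m₂ (middleShifts m₁ m₂ (x + e)) (staircase n₁ n₂ e₀ k 0) →
      Recovers m₁ m₂ (middleShifts m₁ m₂ x) (staircase n₁ n₂ e₀ k e) := by
    intro k e x hk hkn he hen hx hcap h
    refine h.peel (x + e - 1, k + q) ?_ ?_ ?_ ?_
    · rintro p ⟨h1, h2, h3⟩
      exact ⟨h1, by omega, h3⟩
    · intro d hd
      rw [mem_staircase] at hd ⊢
      omega
    · rintro ⟨p1, p2⟩ ⟨h1, h2, h3⟩ ⟨d1, d2⟩ hd
      rw [mem_staircase] at hd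
      dsimp only at h1 h2 h3 hd
      constructor <;> rintro ⟨hc1, hc2⟩ <;>
      dsimp only [Prod.fst_add, Prod.snd_add, Prod.fst_sub, Prod.snd_sub] at hc1 hc2 <;>
      have hc2 := eq_of_dvd_of_lt_three_mul hc2 (by omega) (by omega) <;>
      have hc1 := eq_of_dvd_of_lt_three_mul hc1 (by omega) (by omega) <;> omega
    · rintro ⟨d1, d2⟩ hd hd'
      rw [mem_staircase] at hd hd'
      dsimp only at hd hd'
      refine ⟨(x + e - 1 - d1, q), ⟨hq, ?_, ?_⟩, ⟨?_, ?_⟩, ?_⟩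
      · dsimp only; omega
      · dsimp only; omega
      · dsimp only [Prod.fst_add]; exact ⟨0, by ring⟩
      · dsimp only [Prod.snd_add]; exact ⟨0, by omega⟩
      · rintro ⟨f1, f2⟩ hf hne
        rw [mem_staircase] at hf
        rw [Ne, Prod.ext_iff] at hne
        dsimp only at hf hne
        constructor <;> rintro ⟨hc1, hc2⟩ <;>
        dsimp only [Prod.fst_add, Prod.snd_add, Prod.fst_sub, Prod.snd_sub] at hc1 hc2 <;>
        have hc2 := eq_of_dvd_of_lt_three_mul hc2 (by omega) (by omega) <;>
        have hc1 := eq_of_dvd_of_lt_three_mul hc1 (by omega) (by omega) <;> omega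
  induction k with
  | zero =>
    intro e x hk he hen hx hcap
    refine step _ e x le_rfl hk he hen hx (by simpa using hcap) ?_
    convert Recovers.of_empty _ _ _
    ext d
    rw [mem_staircase]
    simp
    omega
  | succ k ih =>
    intro e x hk he hen hx hcap
    push_cast at hk hcap ⊢
    have hk0 : (0 : ℤ) ≤ k * e₀ := by positivity
    rw [add_mul, one_mul] at hcap
    refine step _ e x (by omega) hk he hen hx (by omega) ?_
    convert ih e₀ (x + e) (by omega) he₀ he₀n (by omega) (by omega) using 1
    ext d
    rw [mem_staircase, mem_staircase]
    omega

/-- Above the middle row signs do not interfere: `d.2 - p.2 ≡ k + q` would need `p.2 + q ≤ m₂`.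
Unknowns and shifts are consumed one for one, the capacity bound being the number of shifts left.
`N` bounds a measure that drops whenever a column or a row of shifts is used up. -/
theorem recovers_upperShifts {m₁ m₂ n₁ n₂ e₀ : ℤ} (hn₁ : n₁ ≤ m₁) (hn₂ : 2 * n₂ ≤ m₂)
    (he₀ : 0 ≤ e₀) (he₀n : e₀ ≤ n₁) (N : ℕ) :
    ∀ k e q x : ℤ, k + (q - m₂ / 2) ≤ N → -1 ≤ k → k < n₂ → 0 ≤ e → e ≤ n₁ → m₂ < 2 * q →
      q ≤ m₂ - n₂ → 0 ≤ x → x ≤ m₁ →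
      e + k * e₀ ≤ (m₁ - x) + (q - 1 - m₂ / 2) * m₁ + (if 2 ∣ m₂ then m₁ / 2 + 1 else 0) →
      Recovers m₁ m₂ (upperShifts m₁ m₂ q x) (staircase n₁ n₂ e₀ k e) := by
  -- One mass removes the top `w` unknowns of column `k` by the shifts `x, …, x + w - 1` of row `q`.
  -- It must exhaust the column or the row: otherwise the shift `x + w` would carry the unknown at
  -- height `e - 1 - w` onto the mass.
  have step : ∀ k e q x : ℤ, 0 ≤ k → k < n₂ → 0 ≤ e → e ≤ n₁ → m₂ < 2 * q →
      q ≤ m₂ - n₂ → 0 ≤ x → x ≤ m₁ → ∀ w, 0 ≤ w → w ≤ e → w ≤ m₁ - x → (w = e ∨ w = m₁ - x) →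
      Recovers m₁ m₂ (upperShifts m₁ m₂ q (x + w)) (staircase n₁ n₂ e₀ k (e - w)) →
      Recovers m₁ m₂ (upperShifts m₁ m₂ q x) (staircase n₁ n₂ e₀ k e) := by
    intro k e q x hk hkn he hen hmq hqm hx hxm w hw hwe hwx hwor h
    refine h.peel (x + e - 1, k + q) ?_ ?_ ?_ ?_
    · rintro p ((⟨h1, h2, h3⟩ | h) | h)
      · exact Or.inl (Or.inl ⟨h1, by omega, h3⟩)
      · exact Or.inl (Or.inr h)
      · exact Or.inr h
    · intro d hd
      rw [mem_staircase] at hd ⊢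
      omega
    · rintro ⟨p1, p2⟩ hp ⟨d1, d2⟩ hd
      rw [mem_staircase] at hd
      have hp : (p2 = q ∧ x + w ≤ p1 ∧ p1 < m₁) ∨ m₂ ≤ 2 * p2 ∧ p2 < q ∧ 0 ≤ p1 ∧ p1 < m₁ := by
        rcases hp with (h | ⟨h1, h⟩) | ⟨h1, h2, h3⟩
        · exact Or.inl h
        · exact Or.inr ⟨h1.le, h⟩
        · dsimp only at *
          omega
      dsimp only at hd
      constructor <;> rintro ⟨hc1, hc2⟩ <;>
      dsimp only [Prod.fst_add, Prod.snd_add, Prod.fst_sub, Prod.snd_sub] at hc1 hc2 <;>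
      have hc2 := eq_of_dvd_of_lt_three_mul hc2 (by omega) (by omega) <;>
      have hc1 := eq_of_dvd_of_lt_three_mul hc1 (by omega) (by omega) <;> omega
    · rintro ⟨d1, d2⟩ hd hd'
      rw [mem_staircase] at hd hd'
      dsimp only at hd hd'
      refine ⟨(x + e - 1 - d1, q), Or.inl (Or.inl ⟨rfl, ?_, ?_⟩), ⟨?_, ?_⟩, ?_⟩
      · dsimp only; omega
      · dsimp only; omega
      · dsimp only [Prod.fst_add]; exact ⟨0, by ring⟩
      · dsimp only [Prod.snd_add]; exact ⟨0, by omega⟩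
      · rintro ⟨f1, f2⟩ hf hne
        rw [mem_staircase] at hf
        rw [Ne, Prod.ext_iff] at hne
        dsimp only at hf hne
        constructor <;> rintro ⟨hc1, hc2⟩ <;>
        dsimp only [Prod.fst_add, Prod.snd_add, Prod.fst_sub, Prod.snd_sub] at hc1 hc2 <;>
        have hc2 := eq_of_dvd_of_lt_three_mul hc2 (by omega) (by omega) <;>
        have hc1 := eq_of_dvd_of_lt_three_mul hc1 (by omega) (by omega) <;> omega
  have empty : ∀ R e, Recovers m₁ m₂ R (staircase n₁ n₂ e₀ (-1) e) := by
    intro R e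
    convert Recovers.of_empty _ _ _
    ext d
    rw [mem_staircase]
    simp
    omega
  have column : ∀ k, staircase n₁ n₂ e₀ k 0 = staircase n₁ n₂ e₀ (k - 1) e₀ := by
    intro k
    ext d
    rw [mem_staircase, mem_staircase]
    omega
  induction N with
  | zero =>
    intro k e q x hN hk1 hkn he hen hmq hqm hx hxm hcap
    obtain rfl : k = -1 := by omega
    exact empty _ _
  | succ N ih =>
    intro k e q x hN hk1 hkn he hen hmq hqm hx hxm hcap
    push_cast at hN
    obtain rfl | hk1 := hk1.eq_or_lt
    · exact empty _ _
    have hk0 : 0 ≤ k := by omega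
    have hkmul : 0 ≤ k * e₀ := by positivity
    by_cases hex : e ≤ m₁ - x
    · refine step k e q x hk0 hkn he hen hmq hqm hx hxm e he le_rfl hex (Or.inl rfl) ?_
      rw [sub_self, column]
      refine ih (k - 1) e₀ q (x + e) (by omega) (by omega) (by omega) he₀ he₀n hmq hqm (by omega)
        (by omega) ?_
      rw [sub_mul, one_mul]
      omega
    · refine step k e q x hk0 hkn he hen hmq hqm hx hxm (m₁ - x) (by omega) (by omega) le_rfl
        (Or.inr rfl) ?_
      rw [add_sub_cancel]
      by_cases hq : m₂ < 2 * (q - 1)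
      · refine (ih k (e - (m₁ - x)) (q - 1) 0 (by omega) (by omega) hkn (by omega) (by omega) hq
          (by omega) le_rfl (by omega) ?_).mono ?_
        · rw [show (q - 1 - m₂ / 2) * m₁ = m₁ + (q - 1 - 1 - m₂ / 2) * m₁ by ring] at hcap
          omega
        · rintro p ((⟨h1, h2, h3⟩ | ⟨h1, h2, h3⟩) | h)
          · exact Or.inl (Or.inr ⟨by omega, by omega, h2, h3⟩)
          · exact Or.inl (Or.inr ⟨h1, by omega, h3⟩)
          · exact Or.inr h
      -- Row `q` was the lowest above `m₂ / 2`; only the middle row can remain, and it exists only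
      -- for even `m₂`.
      · have hq' : q - 1 - m₂ / 2 = 0 := by omega
        rw [hq', zero_mul] at hcap
        split_ifs at hcap with h2
        · have := recovers_middleShifts hn₁ hn₂ he₀ he₀n (m₂ / 2) (by omega) k.toNat
            (e - (m₁ - x)) 0 (by omega) (by omega) (by omega) le_rfl
            (by rw [Int.toNat_of_nonneg hk0]; omega)
          rw [Int.toNat_of_nonneg hk0] at this
          exact this.mono Set.subset_union_right
        · omega

/-! ### Trimming the block with the shifts whose second coordinate is below `n₂`. -/

/-- The signal positions left after `t` point masses in the last signal column. -/
noncomputable def trimmedBox (n₁ n₂ t r : ℤ) : Finset (ℤ × ℤ) :=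
  (Finset.Ico 0 n₁ ×ˢ Finset.Ico 0 n₂).filter fun d =>
    d.2 < n₂ - 1 ∧ d.1 < n₁ - t ∨ d.2 = n₂ - 1 ∧ d.1 < n₁ - r

theorem mem_trimmedBox {n₁ n₂ t r : ℤ} {d : ℤ × ℤ} : d ∈ trimmedBox n₁ n₂ t r ↔
    ((0 ≤ d.1 ∧ d.1 < n₁) ∧ 0 ≤ d.2 ∧ d.2 < n₂) ∧
      (d.2 < n₂ - 1 ∧ d.1 < n₁ - t ∨ d.2 = n₂ - 1 ∧ d.1 < n₁ - r) := by
  simp [trimmedBox]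

/-- Differences, up to sign, in the rows from `m₂ / 2` to `m₂ - n₂`. -/
def halfShifts (m₁ m₂ n₂ : ℤ) : Set (ℤ × ℤ) :=
  {p | m₂ < 2 * p.2 ∧ p.2 ≤ m₂ - n₂ ∧ 0 ≤ p.1 ∧ p.1 < m₁} ∪
    {p | 2 * p.2 = m₂ ∧ 0 ≤ p.1 ∧ 2 * p.1 ≤ m₁}

/-- Differences, up to sign, in the rows below `n₂` and in the columns from `n₁` to
`m₁ - n₁ - t`. -/
def sideShifts (m₁ n₁ n₂ t : ℤ) : Set (ℤ × ℤ) :=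
  {p | 1 ≤ p.2 ∧ p.2 < n₂ ∧ n₁ ≤ p.1 ∧ p.1 ≤ m₁ - n₁ - t} ∪
    {p | p.2 = 0 ∧ m₁ ≤ 2 * p.1 ∧ p.1 ≤ m₁ - n₁ - t}

/-- One mass removes the unknowns with first coordinate `n₁ - 1 - t`, by the shifts `(m₁ - n₁ - t,
n₂ - 1 - d.2)`. The half shifts miss it, since they move the block to second coordinates from `n₂`
to `m₂ - 1`. The last column uses `p.2 = 0`, where `p` and `-p` share a row; only `(m₁ - 2n₁ + 2) /
2` shifts count there, hence the `min`. -/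
theorem recovers_trim {m₁ m₂ n₁ n₂ : ℤ} (hn₁ : 1 ≤ n₁) (hn₂ : 1 ≤ n₂) (hm₂ : 2 * n₂ ≤ m₂)
    {t : ℤ} (ht : 0 ≤ t) (htn : t < n₁) (htm : t < m₁ - 2 * n₁ + 1)
    (h : Recovers m₁ m₂ (halfShifts m₁ m₂ n₂ ∪ sideShifts m₁ n₁ n₂ (t + 1))
      (trimmedBox n₁ n₂ (t + 1) (min (t + 1) ((m₁ - 2 * n₁ + 2) / 2)))) :
    Recovers m₁ m₂ (halfShifts m₁ m₂ n₂ ∪ sideShifts m₁ n₁ n₂ t)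
      (trimmedBox n₁ n₂ t (min t ((m₁ - 2 * n₁ + 2) / 2))) := by
  refine h.peel (m₁ - 1 - 2 * t, n₂ - 1) ?_ ?_ ?_ ?_
  · rintro p (h | ⟨h1, h2, h3, h4⟩ | ⟨h1, h2, h3⟩)
    · exact Or.inl h
    · exact Or.inr (Or.inl ⟨h1, h2, h3, by omega⟩)
    · exact Or.inr (Or.inr ⟨h1, h2, by omega⟩)
  · intro d hd
    rw [mem_trimmedBox] at hd ⊢
    omega
  · rintro ⟨p1, p2⟩ hp ⟨d1, d2⟩ hd
    rw [mem_trimmedBox] at hd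
    have hp : (m₂ ≤ 2 * p2 ∧ p2 ≤ m₂ - n₂ ∧ 0 ≤ p1 ∧ p1 < m₁) ∨
        (1 ≤ p2 ∧ p2 < n₂ ∧ n₁ ≤ p1 ∧ p1 ≤ m₁ - n₁ - (t + 1)) ∨
        (p2 = 0 ∧ m₁ ≤ 2 * p1 ∧ p1 ≤ m₁ - n₁ - (t + 1)) := by
      rcases hp with (⟨h1, h⟩ | ⟨h1, h2, h3⟩) | h | h
      · exact Or.inl ⟨h1.le, h⟩
      · left
        dsimp only at *
        omega
      · exact Or.inr (Or.inl h)
      · exact Or.inr (Or.inr h)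
    dsimp only at hd
    constructor <;> rintro ⟨hc1, hc2⟩ <;>
    dsimp only [Prod.fst_add, Prod.snd_add, Prod.fst_sub, Prod.snd_sub] at hc1 hc2 <;>
    have hc2 := eq_of_dvd_of_lt_three_mul hc2 (by omega) (by omega) <;>
    have hc1 := eq_of_dvd_of_lt_three_mul hc1 (by omega) (by omega) <;> omega
  · rintro ⟨d1, d2⟩ hd hd'
    rw [mem_trimmedBox] at hd hd'
    dsimp only at hd hd'
    have hd1 : d1 = n₁ - 1 - t := by omega
    refine ⟨(m₁ - n₁ - t, n₂ - 1 - d2), Or.inr ?_, ⟨?_, ?_⟩, ?_⟩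
    · by_cases h2 : d2 = n₂ - 1
      · exact Or.inr ⟨by dsimp only; omega, by dsimp only; omega, le_rfl⟩
      · exact Or.inl ⟨by dsimp only; omega, by dsimp only; omega, by dsimp only; omega, le_rfl⟩
    · dsimp only [Prod.fst_add]; exact ⟨0, by omega⟩
    · dsimp only [Prod.snd_add]; exact ⟨0, by omega⟩
    · rintro ⟨f1, f2⟩ hf hne
      rw [mem_trimmedBox] at hf
      rw [Ne, Prod.ext_iff] at hne
      dsimp only at hf hne
      constructor <;> rintro ⟨hc1, hc2⟩ <;>
      dsimp only [Prod.fst_add, Prod.snd_add, Prod.fst_sub, Prod.snd_sub] at hc1 hc2 <;>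
      have hc2 := eq_of_dvd_of_lt_three_mul hc2 (by omega) (by omega) <;>
      have hc1 := eq_of_dvd_of_lt_three_mul hc1 (by omega) (by omega) <;> omega

theorem recovers_of_recovers_trimmed {m₁ m₂ n₁ n₂ : ℤ} (hn₁ : 1 ≤ n₁) (hn₂ : 1 ≤ n₂)
    (hm₂ : 2 * n₂ ≤ m₂) (T : ℕ) (hTn : T ≤ n₁) (hTm : T = 0 ∨ T ≤ m₁ - 2 * n₁ + 1)
    (h : Recovers m₁ m₂ (halfShifts m₁ m₂ n₂)
      (trimmedBox n₁ n₂ T (min (T : ℤ) ((m₁ - 2 * n₁ + 2) / 2)))) :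
    Recovers m₁ m₂ (halfShifts m₁ m₂ n₂ ∪ sideShifts m₁ n₁ n₂ 0)
      (trimmedBox n₁ n₂ 0 (min 0 ((m₁ - 2 * n₁ + 2) / 2))) := by
  have aux : ∀ t : ℕ, t ≤ T → Recovers m₁ m₂ (halfShifts m₁ m₂ n₂ ∪ sideShifts m₁ n₁ n₂ t)
      (trimmedBox n₁ n₂ t (min (t : ℤ) ((m₁ - 2 * n₁ + 2) / 2))) := by
    intro t ht
    induction ht using Nat.decreasingInduction with
    | self => exact h.mono Set.subset_union_left
    | of_succ t ht ih =>
      push_cast at ih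
      exact recovers_trim hn₁ hn₂ hm₂ (by omega) (by omega) (by omega) ih
  simpa using aux 0 (Nat.zero_le T)

/-! ### Counting equations against unknowns. -/

/-- Differences that are not differences of two positions of an `n₁ × n₂` block. -/
def farShifts (m₁ m₂ n₁ n₂ : ℤ) : Set (ℤ × ℤ) :=
  {p | (0 ≤ p.1 ∧ p.1 < m₁ ∧ 0 ≤ p.2 ∧ p.2 < m₂) ∧
    (n₁ ≤ p.1 ∧ p.1 ≤ m₁ - n₁ ∨ n₂ ≤ p.2 ∧ p.2 ≤ m₂ - n₂)}

theorem recovers_farShifts_of_two_mul_le {m₁ m₂ n₁ n₂ : ℤ} (hn₁ : 1 ≤ n₁) (hn₂ : 1 ≤ n₂)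
    (hm₁ : n₁ ≤ m₁) (hm₂ : 2 * n₂ ≤ m₂)
    (h : (2 * n₁ - 1) * (3 * n₂ - 1) + n₂ ≤ m₁ * m₂) :
    Recovers m₁ m₂ (farShifts m₁ m₂ n₁ n₂) (Finset.Ico 0 n₁ ×ˢ Finset.Ico 0 n₂) := by
  obtain ⟨T, hT⟩ : ∃ T : ℕ, (T : ℤ) = max 0 (min n₁ (m₁ - 2 * n₁ + 1)) :=
    ⟨_, Int.toNat_of_nonneg (le_max_left _ _)⟩
  obtain ⟨r, hr⟩ : ∃ r : ℤ, r = max 0 (min (T : ℤ) ((m₁ - 2 * n₁ + 2) / 2)) := ⟨_, rfl⟩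
  have hbox : Finset.Ico 0 n₁ ×ˢ Finset.Ico 0 n₂ =
      trimmedBox n₁ n₂ 0 (min 0 ((m₁ - 2 * n₁ + 2) / 2)) := by
    ext d
    rw [mem_trimmedBox, Finset.mem_product, Finset.mem_Ico, Finset.mem_Ico]
    omega
  rw [hbox]
  have hsub : halfShifts m₁ m₂ n₂ ∪ sideShifts m₁ n₁ n₂ 0 ⊆ farShifts m₁ m₂ n₁ n₂ := by
    rintro p ((⟨h1, h2, h3, h4⟩ | ⟨h1, h2, h3⟩) | ⟨h1, h2, h3, h4⟩ | ⟨h1, h2, h3⟩)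
    · exact ⟨by omega, by omega⟩
    · exact ⟨by omega, by omega⟩
    · exact ⟨by omega, by omega⟩
    · exact ⟨by omega, by omega⟩
  refine (recovers_of_recovers_trimmed hn₁ hn₂ hm₂ T (by omega) (by omega) ?_).mono hsub
  have htrim : trimmedBox n₁ n₂ T (min (T : ℤ) ((m₁ - 2 * n₁ + 2) / 2)) =
      staircase n₁ n₂ (n₁ - T) (n₂ - 1) (n₁ - r) := by
    ext d
    rw [mem_trimmedBox, mem_staircase]
    omega
  rw [htrim]
  -- Twice the unknowns left after trimming is at most the number of shifts with second coordinate
  -- from `n₂` to `m₂ - n₂`, counted with both signs. The cases are: no trimming, all side shifts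
  -- used, all columns but the last emptied.
  have hcount : 2 * ((n₁ - r) + (n₂ - 1) * (n₁ - T)) ≤ m₁ * (m₂ - 2 * n₂ + 1) := by
    obtain hT0 | hT0 := (Int.natCast_nonneg T).eq_or_lt
    · have hr0 : r = 0 := by omega
      have : m₁ ≤ 2 * n₁ - 1 := by omega
      rw [hr0, ← hT0]
      nlinarith
    by_cases hc : m₁ - 2 * n₁ + 1 ≤ n₁
    · have hTc : (T : ℤ) = m₁ - 2 * n₁ + 1 := by omega
      have hr2 : m₁ - 2 * n₁ + 1 ≤ 2 * r := by omega
      rw [hTc]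
      nlinarith
    · have hTc : (T : ℤ) = n₁ := by omega
      rw [hTc, sub_self, mul_zero]
      have : 0 ≤ m₁ * (m₂ - 2 * n₂) := mul_nonneg (by omega) (by omega)
      have : 0 ≤ r := by omega
      linarith
  have h0T : 0 ≤ (n₂ - 1) * (n₁ - T) := mul_nonneg (by omega) (by omega)
  obtain hm | hm := hm₂.eq_or_lt
  · have := recovers_middleShifts (m₁ := m₁) (m₂ := m₂) (e₀ := n₁ - T) hm₁ hm₂ (by omega)
      (by omega) n₂ hm (n₂ - 1).toNat (n₁ - r) 0 (by omega) (by omega) (by omega) le_rfl (by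
        rw [Int.toNat_of_nonneg (by omega)]
        rw [← hm, show 2 * n₂ - 2 * n₂ + 1 = 1 by ring, mul_one] at hcount
        omega)
    rw [Int.toNat_of_nonneg (by omega)] at this
    exact this.mono Set.subset_union_right
  · refine (recovers_upperShifts (m₁ := m₁) (m₂ := m₂) (e₀ := n₁ - T) hm₁ hm₂ (by omega)
      (by omega) (n₂ + m₂).toNat (n₂ - 1) (n₁ - r) (m₂ - n₂) 0 (by omega) (by omega) (by omega)
      (by omega) (by omega) (by omega) (by omega) le_rfl (by omega) ?_).mono ?_
    · obtain ⟨j, hj | hj⟩ := Int.even_or_odd' m₂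
      · rw [if_pos ⟨j, hj⟩, show m₂ - n₂ - 1 - m₂ / 2 = j - n₂ - 1 by omega]
        rw [hj, show m₁ * (2 * j - 2 * n₂ + 1) = 2 * ((j - n₂ - 1) * m₁) + 3 * m₁ by ring]
          at hcount
        omega
      · rw [if_neg (by omega), show m₂ - n₂ - 1 - m₂ / 2 = j - n₂ by omega]
        rw [hj, show m₁ * (2 * j + 1 - 2 * n₂ + 1) = 2 * ((j - n₂) * m₁) + 2 * m₁ by ring]
          at hcount
        omega
    · rintro p ((⟨h1, h2, h3⟩ | ⟨h1, h2, h3⟩) | h)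
      · exact Or.inl ⟨by omega, by omega, h2, h3⟩
      · exact Or.inl ⟨h1, by omega, h3⟩
      · exact Or.inr h

theorem recovers_farShifts {m₁ m₂ n₁ n₂ : ℤ} (hn₁ : 1 ≤ n₁) (hn₂ : 1 ≤ n₂)
    (hm₁ : n₁ ≤ m₁) (hm₂ : n₂ ≤ m₂) (h : (2 * n₁ - 1) * (3 * n₂ - 1) + n₂ ≤ m₁ * m₂) :
    Recovers m₁ m₂ (farShifts m₁ m₂ n₁ n₂) (Finset.Ico 0 n₁ ×ˢ Finset.Ico 0 n₂) := by
  by_cases h2 : 2 * n₂ ≤ m₂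
  · exact recovers_farShifts_of_two_mul_le hn₁ hn₂ hm₁ h2 h
  -- The bound equals `6n₁n₂ - 2n₁ - 2n₂ + 1`. It exceeds `(2n₁-1)(2n₂-1)`, so one side is long
  -- enough, and it is symmetric, so the coordinates may be exchanged.
  have h1 : 2 * n₁ ≤ m₁ := by
    by_contra h1
    nlinarith
  have hswap := (recovers_farShifts_of_two_mul_le hn₂ hn₁ hm₂ h1
    (by linarith [mul_comm m₁ m₂])).swap
  have hsub : Prod.swap ⁻¹' farShifts m₂ m₁ n₂ n₁ ⊆ farShifts m₁ m₂ n₁ n₂ := by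
    rintro p ⟨⟨h3, h4, h5, h6⟩, h7⟩
    exact ⟨⟨h5, h6, h3, h4⟩, h7.symm⟩
  convert hswap.mono hsub using 1
  ext d
  simp only [Finset.mem_product, Finset.mem_map, Equiv.coe_toEmbedding, Prod.exists]
  constructor
  · intro hd
    exact ⟨d.2, d.1, ⟨hd.2, hd.1⟩, rfl⟩
  · rintro ⟨a, b, ⟨ha, hb⟩, rfl⟩
    exact ⟨hb, ha⟩

/-! ### Null sets of polynomials and Gram determinants. -/

/-- Fubini in the first variable: only finitely many of its values make the polynomial in the other
variables vanish identically. -/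
theorem ae_eval_ne_zero_fin (ν : Measure ℝ) [SigmaFinite ν] [NullSingletonClass ν] (n : ℕ) :
    ∀ q : MvPolynomial (Fin n) ℝ, q ≠ 0 →
      ∀ᵐ x ∂Measure.pi (fun _ : Fin n => ν), MvPolynomial.eval x q ≠ 0 := by
  induction n with
  | zero =>
    intro q hq
    refine Filter.Eventually.of_forall fun x hx => hq ?_
    rw [MvPolynomial.eq_C_of_isEmpty q] at hx ⊢
    rw [MvPolynomial.eval_C] at hx
    rw [hx, MvPolynomial.C_0]
  | succ n ih =>
    intro q hq
    set f := MvPolynomial.finSuccEquiv ℝ n q with hf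
    have hf0 : f ≠ 0 := by
      rw [hf]
      exact (map_ne_zero_iff _ (MvPolynomial.finSuccEquiv ℝ n).injective).2 hq
    have heval : ∀ a : ℝ, ∀ x : Fin n → ℝ, MvPolynomial.eval (Fin.cons a x : Fin (n + 1) → ℝ) q =
        MvPolynomial.eval x (f.eval (MvPolynomial.C a)) := by
      intro a x
      rw [MvPolynomial.eval_eq_eval_mv_eval', ← Polynomial.eval₂_at_apply, Polynomial.eval_map,
        MvPolynomial.eval_C]
    have hfin : ∀ᵐ a ∂ν, f.eval (MvPolynomial.C a) ≠ 0 := by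
      have : {a : ℝ | f.eval (MvPolynomial.C a) = 0}.Finite := by
        refine Set.Finite.preimage (MvPolynomial.C_injective _ _).injOn
          (s := {b | f.eval b = 0}) ?_
        exact Polynomial.finite_setOfPred_isRoot hf0
      simpa [ae_iff] using this.measure_zero ν
    have hprod : ∀ᵐ z ∂ν.prod (Measure.pi fun _ : Fin n => ν),
        MvPolynomial.eval (Fin.cons z.1 z.2 : Fin (n + 1) → ℝ) q ≠ 0 := by
      rw [Measure.ae_prod_iff_ae_ae]
      · filter_upwards [hfin] with a ha
        filter_upwards [ih _ ha] with x hx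
        rwa [heval]
      · have : Continuous fun z : ℝ × (Fin n → ℝ) =>
            MvPolynomial.eval (Fin.cons z.1 z.2 : Fin (n + 1) → ℝ) q :=
          (MvPolynomial.continuous_eval q).comp (by fun_prop)
        exact (this.measurable (measurableSet_singleton 0)).compl
    have hmp := measurePreserving_piFinSuccAbove (fun _ : Fin (n + 1) => ν) 0
    have := hmp.quasiMeasurePreserving.ae hprod
    filter_upwards [this] with x hx
    convert hx using 2
    simp [MeasurableEquiv.piFinSuccAbove]

/-- The zeros of a nonzero polynomial form a null set for a product of atomless measures. -/
theorem ae_eval_ne_zero {ι : Type*} [Fintype ι] (ν : Measure ℝ) [SigmaFinite ν] [NullSingletonClass ν]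
    {q : MvPolynomial ι ℝ} (hq : q ≠ 0) :
    ∀ᵐ x ∂Measure.pi (fun _ : ι => ν), MvPolynomial.eval x q ≠ 0 := by
  let e := Fintype.equivFin ι
  have h := ae_eval_ne_zero_fin ν _ (MvPolynomial.rename e q)
    ((map_ne_zero_iff _ (MvPolynomial.rename_injective e e.injective)).2 hq)
  have hmp := measurePreserving_piCongrLeft (fun _ : Fin (Fintype.card ι) => ν) e
  filter_upwards [hmp.quasiMeasurePreserving.ae h] with x hx
  rw [MvPolynomial.eval_rename] at hx
  convert hx using 3
  funext i
  exact (MeasurableEquiv.piCongrLeft_apply_apply (β := fun _ => ℝ) e x i).symm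

theorem det_transpose_mul_self_ne_zero_iff {ι κ : Type*} [Fintype ι] [Fintype κ] [DecidableEq κ]
    (B : Matrix ι κ ℝ) : (Bᵀ * B).det ≠ 0 ↔ ∀ v, B *ᵥ v = 0 → v = 0 := by
  rw [← not_iff_not, not_not, ← Matrix.exists_mulVec_eq_zero_iff]
  push Not
  refine exists_congr fun v => ?_
  rw [and_comm, ← Matrix.conjTranspose_eq_transpose_of_trivial,
    Matrix.conjTranspose_mul_self_mulVec_eq_zero]

/-! ### From intensities to the cyclic autocorrelation. -/

theorem sum_exp_eq (m : ℕ) [NeZero m] (t : ℤ) :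
    ∑ p : Fin m, (Complex.exp (2 * Real.pi * Complex.I / m) ^ t) ^ (p : ℕ) =
      if (m : ℤ) ∣ t then (m : ℂ) else 0 := by
  have hζ := Complex.isPrimitiveRoot_exp m (NeZero.ne m)
  rw [Fin.sum_univ_eq_sum_range (fun p => (Complex.exp (2 * Real.pi * Complex.I / m) ^ t) ^ p) m]
  split_ifs with h
  · rw [(hζ.zpow_eq_one_iff_dvd t).2 h]
    simp
  · have h1 : Complex.exp (2 * Real.pi * Complex.I / m) ^ t ≠ 1 :=
      fun h1 => h ((hζ.zpow_eq_one_iff_dvd t).1 h1)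
    rw [geom_sum_eq h1, ← zpow_natCast, zpow_comm, zpow_natCast, hζ.pow_eq_one, _root_.one_zpow, sub_self,
      zero_div]

theorem fourierMatrix_eq_pow {m : ℕ} (j l : Fin m) :
    fourierMatrix m j l = Complex.exp (2 * Real.pi * Complex.I / m) ^ ((j : ℕ) * (l : ℕ)) := by
  rw [fourierMatrix, Matrix.of_apply, ← Complex.exp_nat_mul]
  congr 1
  push_cast
  ring

theorem star_exp_two_pi (m : ℕ) : star (Complex.exp (2 * Real.pi * Complex.I / m)) =
    (Complex.exp (2 * Real.pi * Complex.I / m))⁻¹ := by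
  rw [← Complex.exp_neg, ← starRingEnd_apply, ← Complex.exp_conj]
  congr 1
  simp [neg_div, Complex.conj_ofNat]

/-- The position of an entry of an `m₁ × m₂` array as a pair of integers. -/
def position {m₁ m₂ : ℕ} (j : Fin m₁ × Fin m₂) : ℤ × ℤ := ((j.1 : ℕ), (j.2 : ℕ))

open Classical in
/-- The cyclic autocorrelation of an array. -/
noncomputable def autocorrelation {m₁ m₂ : ℕ} (Z : Matrix (Fin m₁) (Fin m₂) ℝ) (r : ℤ × ℤ) : ℝ :=
  ∑ s : Fin m₁ × Fin m₂, ∑ s' : Fin m₁ × Fin m₂,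
    Z s.1 s.2 * Z s'.1 s'.2 * if TorusCongr m₁ m₂ (position s' + r) (position s) then 1 else 0

theorem intensity_eq_sum {m₁ m₂ : ℕ} (Z : Matrix (Fin m₁) (Fin m₂) ℝ) (p : Fin m₁) (q : Fin m₂) :
    (intensity Z p q : ℂ) = ∑ s : Fin m₁ × Fin m₂, ∑ s' : Fin m₁ × Fin m₂,
      (Z s.1 s.2 * Z s'.1 s'.2) *
        ((Complex.exp (2 * Real.pi * Complex.I / m₁) ^ ((s'.1 : ℤ) - s.1)) ^ (p : ℕ) *
        (Complex.exp (2 * Real.pi * Complex.I / m₂) ^ ((s'.2 : ℤ) - s.2)) ^ (q : ℕ)) := by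
  set ζ₁ := Complex.exp (2 * Real.pi * Complex.I / m₁) with h₁
  set ζ₂ := Complex.exp (2 * Real.pi * Complex.I / m₂) with h₂
  have hζ₁ : ζ₁ ≠ 0 := Complex.exp_ne_zero _
  have hζ₂ : ζ₂ ≠ 0 := Complex.exp_ne_zero _
  have hF : ((fourierMatrix m₁)ᴴ * Z.map (fun x : ℝ => (x : ℂ)) * (fourierMatrix m₂)ᴴ) p q =
      ∑ s : Fin m₁ × Fin m₂, (Z s.1 s.2 : ℂ) *
        (ζ₁⁻¹ ^ ((s.1 : ℕ) * (p : ℕ)) * ζ₂⁻¹ ^ ((s.2 : ℕ) * (q : ℕ))) := by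
    rw [Fintype.sum_prod_type_right]
    simp only [Matrix.mul_apply, Matrix.conjTranspose_apply, fourierMatrix_eq_pow, star_pow,
      star_exp_two_pi, Matrix.map_apply, Finset.sum_mul]
    refine Finset.sum_congr rfl fun l _ => Finset.sum_congr rfl fun j _ => ?_
    rw [mul_comm (q : ℕ)]
    ring
  have hF' : star (((fourierMatrix m₁)ᴴ * Z.map (fun x : ℝ => (x : ℂ)) * (fourierMatrix m₂)ᴴ) p q) =
      ∑ s : Fin m₁ × Fin m₂, (Z s.1 s.2 : ℂ) *
        (ζ₁ ^ ((s.1 : ℕ) * (p : ℕ)) * ζ₂ ^ ((s.2 : ℕ) * (q : ℕ))) := by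
    rw [hF, star_sum]
    refine Finset.sum_congr rfl fun s _ => ?_
    simp only [star_mul', star_pow, star_inv₀, h₁, h₂, star_exp_two_pi, inv_inv]
    simp
  rw [intensity, Matrix.of_apply, Complex.ofReal_pow, ← Complex.mul_conj', starRingEnd_apply, hF',
    hF, Finset.sum_mul_sum]
  refine Finset.sum_congr rfl fun s _ => Finset.sum_congr rfl fun s' _ => ?_
  rw [zpow_sub₀ hζ₁, zpow_sub₀ hζ₂]
  simp only [zpow_natCast, div_eq_mul_inv, mul_pow, pow_mul, inv_pow]
  ring

/-- Discrete Wiener–Khinchin: orthogonality of characters inverts the Fourier transform of the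
squared modulus. -/
theorem autocorrelation_eq_sum_intensity {m₁ m₂ : ℕ} [NeZero m₁] [NeZero m₂]
    (Z : Matrix (Fin m₁) (Fin m₂) ℝ) (r : ℤ × ℤ) :
    ∑ p : Fin m₁, ∑ q : Fin m₂, (intensity Z p q : ℂ) *
      ((Complex.exp (2 * Real.pi * Complex.I / m₁) ^ r.1) ^ (p : ℕ) *
      (Complex.exp (2 * Real.pi * Complex.I / m₂) ^ r.2) ^ (q : ℕ)) =
    (m₁ : ℂ) * m₂ * autocorrelation Z r := by
  simp only [intensity_eq_sum, Finset.sum_mul]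
  rw [Finset.sum_congr rfl fun p _ => Finset.sum_comm, Finset.sum_comm, autocorrelation,
    Complex.ofReal_sum, Finset.mul_sum]
  refine Finset.sum_congr rfl fun s _ => ?_
  rw [Finset.sum_congr rfl fun p _ => Finset.sum_comm, Finset.sum_comm, Complex.ofReal_sum,
    Finset.mul_sum]
  refine Finset.sum_congr rfl fun s' _ => ?_
  have hζ₁ := Complex.exp_ne_zero (2 * Real.pi * Complex.I / m₁)
  have hζ₂ := Complex.exp_ne_zero (2 * Real.pi * Complex.I / m₂)
  calc _ = (Z s.1 s.2 * Z s'.1 s'.2 : ℂ) *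
      ((∑ p : Fin m₁, (Complex.exp (2 * Real.pi * Complex.I / m₁) ^
        ((s'.1 : ℤ) + r.1 - s.1)) ^ (p : ℕ)) *
      ∑ q : Fin m₂, (Complex.exp (2 * Real.pi * Complex.I / m₂) ^
        ((s'.2 : ℤ) + r.2 - s.2)) ^ (q : ℕ)) := by
        rw [Finset.sum_mul_sum, Finset.mul_sum]
        refine Finset.sum_congr rfl fun p _ => ?_
        rw [Finset.mul_sum]
        refine Finset.sum_congr rfl fun q _ => ?_
        rw [show (s'.1 : ℤ) + r.1 - s.1 = s'.1 - s.1 + r.1 by ring, zpow_add₀ hζ₁,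
          show (s'.2 : ℤ) + r.2 - s.2 = s'.2 - s.2 + r.2 by ring, zpow_add₀ hζ₂, mul_pow, mul_pow]
        ring
    _ = _ := by
        rw [sum_exp_eq, sum_exp_eq]
        unfold TorusCongr position
        dsimp only [Prod.fst_add, Prod.snd_add]
        by_cases h1 : (m₁ : ℤ) ∣ (s'.1 : ℤ) + r.1 - s.1 <;>
        by_cases h2 : (m₂ : ℤ) ∣ (s'.2 : ℤ) + r.2 - s.2 <;> simp [h1, h2]
        ring

theorem autocorrelation_eq_of_intensity_eq {m₁ m₂ : ℕ} [NeZero m₁] [NeZero m₂]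
    {Z Z' : Matrix (Fin m₁) (Fin m₂) ℝ} (h : intensity Z = intensity Z') (r : ℤ × ℤ) :
    autocorrelation Z r = autocorrelation Z' r := by
  have := autocorrelation_eq_sum_intensity Z r
  rw [h, autocorrelation_eq_sum_intensity Z' r] at this
  have hm : (m₁ : ℂ) * m₂ ≠ 0 :=
    mul_ne_zero (Nat.cast_ne_zero.2 (NeZero.ne _)) (Nat.cast_ne_zero.2 (NeZero.ne _))
  exact_mod_cast (mul_left_cancel₀ hm this).symm

/-! ### The linear system of a background and its generic injectivity. -/

variable {n₁ n₂ k₁ k₂ a₁ a₂ : ℕ}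

instance : DecidablePred (· ∈ region n₁ n₂ k₁ k₂ a₁ a₂) := fun p =>
  inferInstanceAs (Decidable ((a₁ ≤ (p.1 : ℕ) ∧ (p.1 : ℕ) < a₁ + n₁) ∧
    (a₂ ≤ (p.2 : ℕ) ∧ (p.2 : ℕ) < a₂ + n₂)))

open Classical in
/-- The periodic extension to `ℤ × ℤ` of a background, set to zero on the region. -/
noncomputable def periodicExtension
    (v : {p // p ∉ region n₁ n₂ k₁ k₂ a₁ a₂} → ℝ) (x : ℤ × ℤ) : ℝ :=
  ∑ i, v i * if TorusCongr (n₁ + k₁ : ℕ) (n₂ + k₂ : ℕ) x (position i.1) then 1 else 0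

theorem eq_of_torusCongr_position {m₁ m₂ : ℕ} {i j : Fin m₁ × Fin m₂} {x : ℤ × ℤ}
    (hi : TorusCongr m₁ m₂ x (position i)) (hj : TorusCongr m₁ m₂ x (position j)) : i = j := by
  obtain ⟨h1, h2⟩ := hi.trans_iff.1 hj
  have hi1 := i.1.isLt
  have hi2 := i.2.isLt
  have hj1 := j.1.isLt
  have hj2 := j.2.isLt
  dsimp only [position] at h1 h2
  have := eq_of_dvd_of_lt_three_mul h1 (by omega) (by omega)
  have := eq_of_dvd_of_lt_three_mul h2 (by omega) (by omega)
  exact Prod.ext (Fin.ext (by omega)) (Fin.ext (by omega))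

theorem exists_torusCongr_position {m₁ m₂ : ℕ} [NeZero m₁] [NeZero m₂] (x : ℤ × ℤ) :
    ∃ i : Fin m₁ × Fin m₂, TorusCongr m₁ m₂ x (position i) := by
  have h1 : (0 : ℤ) < m₁ := by exact_mod_cast NeZero.pos m₁
  have h2 : (0 : ℤ) < m₂ := by exact_mod_cast NeZero.pos m₂
  have h3 := Int.emod_nonneg x.1 h1.ne'
  have h4 := Int.emod_nonneg x.2 h2.ne'
  have h5 := Int.emod_lt_of_pos x.1 h1
  have h6 := Int.emod_lt_of_pos x.2 h2
  refine ⟨(⟨(x.1 % m₁).toNat, by omega⟩, ⟨(x.2 % m₂).toNat, by omega⟩), ?_, ?_⟩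
  · dsimp only [position]
    rw [Int.toNat_of_nonneg h3]
    exact Int.dvd_self_sub_emod
  · dsimp only [position]
    rw [Int.toNat_of_nonneg h4]
    exact Int.dvd_self_sub_emod

theorem periodicExtension_apply (v : {p // p ∉ region n₁ n₂ k₁ k₂ a₁ a₂} → ℝ) {x : ℤ × ℤ}
    (i : {p // p ∉ region n₁ n₂ k₁ k₂ a₁ a₂})
    (h : TorusCongr (n₁ + k₁ : ℕ) (n₂ + k₂ : ℕ) x (position i.1)) :
    periodicExtension v x = v i := by
  rw [periodicExtension, Finset.sum_eq_single i, if_pos h, mul_one]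
  · intro j _ hj
    rw [if_neg, mul_zero]
    exact fun hj' => hj (Subtype.ext (eq_of_torusCongr_position hj' h))
  · exact fun hi => absurd (Finset.mem_univ i) hi

theorem notMem_region_of_add {i j : Fin (n₁ + k₁) × Fin (n₂ + k₂)} {p : ℤ × ℤ}
    (hp : p ∈ farShifts (n₁ + k₁ : ℕ) (n₂ + k₂ : ℕ) n₁ n₂) (hj : j ∈ region n₁ n₂ k₁ k₂ a₁ a₂)
    (h : TorusCongr (n₁ + k₁ : ℕ) (n₂ + k₂ : ℕ) (position j + p) (position i)) :
    i ∉ region n₁ n₂ k₁ k₂ a₁ a₂ := by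
  rintro ⟨⟨hi1, hi2⟩, hi3, hi4⟩
  obtain ⟨⟨hj1, hj2⟩, hj3, hj4⟩ := hj
  obtain ⟨⟨hp1, hp2, hp3, hp4⟩, hp5⟩ := hp
  obtain ⟨h1, h2⟩ := h
  dsimp only [position, Prod.fst_add, Prod.snd_add] at h1 h2
  have := eq_of_dvd_of_lt_three_mul h1 (by omega) (by omega)
  have := eq_of_dvd_of_lt_three_mul h2 (by omega) (by omega)
  omega

theorem torusCongr_sub_iff {m₁ m₂ : ℤ} {a b p : ℤ × ℤ} :
    TorusCongr m₁ m₂ (a - p) b ↔ TorusCongr m₁ m₂ (b + p) a := by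
  unfold TorusCongr
  dsimp only [Prod.fst_add, Prod.snd_add, Prod.fst_sub, Prod.snd_sub]
  rw [← dvd_neg, ← dvd_neg (b := a.2 - p.2 - b.2)]
  ring_nf

theorem notMem_region_of_sub {i j : Fin (n₁ + k₁) × Fin (n₂ + k₂)} {p : ℤ × ℤ}
    (hp : p ∈ farShifts (n₁ + k₁ : ℕ) (n₂ + k₂ : ℕ) n₁ n₂) (hj : j ∈ region n₁ n₂ k₁ k₂ a₁ a₂)
    (h : TorusCongr (n₁ + k₁ : ℕ) (n₂ + k₂ : ℕ) (position j - p) (position i)) :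
    i ∉ region n₁ n₂ k₁ k₂ a₁ a₂ :=
  fun hi => notMem_region_of_add hp hi (torusCongr_sub_iff.1 h) hj

/-- A background whose linear equations at the far shifts have only the trivial solution. -/
def IsDetermining (v : {p // p ∉ region n₁ n₂ k₁ k₂ a₁ a₂} → ℝ) : Prop :=
  ∀ W : {p // p ∈ region n₁ n₂ k₁ k₂ a₁ a₂} → ℝ,
    (∀ p ∈ farShifts (n₁ + k₁ : ℕ) (n₂ + k₂ : ℕ) n₁ n₂, ∑ j, W j *
      (periodicExtension v (position j.1 + p) + periodicExtension v (position j.1 - p)) = 0) →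
    W = 0

theorem exists_isDetermining (hn₁ : 1 ≤ n₁) (hn₂ : 1 ≤ n₂) (ha₁ : a₁ ≤ k₁) (ha₂ : a₂ ≤ k₂)
    (h : (2 * (n₁ : ℤ) - 1) * (3 * (n₂ : ℤ) - 1) + (n₂ : ℤ)
          ≤ ((n₁ : ℤ) + (k₁ : ℤ)) * ((n₂ : ℤ) + (k₂ : ℤ))) :
    ∃ v : {p // p ∉ region n₁ n₂ k₁ k₂ a₁ a₂} → ℝ, IsDetermining v := by
  have : NeZero (n₁ + k₁) := ⟨by omega⟩
  have : NeZero (n₂ + k₂) := ⟨by omega⟩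
  obtain ⟨y, hy, hrec⟩ := recovers_farShifts (m₁ := (n₁ + k₁ : ℕ)) (m₂ := (n₂ + k₂ : ℕ))
    (n₁ := n₁) (n₂ := n₂) (by omega) (by omega) (by omega) (by omega) (by push_cast; exact h)
  let a : ℤ × ℤ := (a₁, a₂)
  -- `y` is built for the block at the origin and is translated to the region. Its values on the
  -- region are dropped, which is harmless because far shifts move block positions off the block.
  refine ⟨fun i => y (position i.1 - a), fun W hW => ?_⟩
  let emb : {p // p ∈ region n₁ n₂ k₁ k₂ a₁ a₂} ↪ ℤ × ℤ :=
    ⟨fun j => position j.1 - a, fun i j hij => Subtype.ext <| by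
      have hij' : position i.1 = position j.1 := sub_left_injective hij
      exact eq_of_torusCongr_position (x := position i.1) ⟨by simp, by simp⟩
        (hij' ▸ ⟨by simp, by simp⟩)⟩
  have hemb : ∀ j, emb j = position j.1 - a := fun _ => rfl
  have hbox : Finset.Ico 0 (n₁ : ℤ) ×ˢ Finset.Ico 0 (n₂ : ℤ) = Finset.univ.map emb := by
    ext d
    simp only [Finset.mem_product, Finset.mem_Ico, Finset.mem_map, Finset.mem_univ, true_and,
      Subtype.exists, hemb, a]
    constructor
    · rintro ⟨⟨h1, h2⟩, h3, h4⟩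
      refine ⟨(⟨a₁ + d.1.toNat, by omega⟩, ⟨a₂ + d.2.toNat, by omega⟩),
        ⟨⟨?_, ?_⟩, ?_, ?_⟩, Prod.ext ?_ ?_⟩ <;>
      simp only [position, Prod.fst_sub, Prod.snd_sub] <;> omega
    · rintro ⟨i, ⟨⟨h1, h2⟩, h3, h4⟩, rfl⟩
      simp only [position, Prod.fst_sub, Prod.snd_sub]
      omega
  have hext : ∀ x i, i ∉ region n₁ n₂ k₁ k₂ a₁ a₂ →
      TorusCongr (n₁ + k₁ : ℕ) (n₂ + k₂ : ℕ) x (position i) →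
      periodicExtension (fun i : {p // p ∉ region n₁ n₂ k₁ k₂ a₁ a₂} => y (position i.1 - a)) x =
        y (x - a) := by
    intro x i hi hx
    rw [periodicExtension_apply _ ⟨i, hi⟩ hx]
    refine (hy _ _ ?_).symm
    simpa [TorusCongr] using hx
  have hE : ∀ j, Function.extend emb W 0 (emb j) = W j := fun j => emb.injective.extend_apply _ _ _
  have key := hrec (Function.extend emb W 0) fun p hp => by
    rw [hbox, Finset.sum_map, ← hW p hp]
    refine Finset.sum_congr rfl fun j _ => ?_
    obtain ⟨i, hi⟩ := exists_torusCongr_position (m₁ := n₁ + k₁) (m₂ := n₂ + k₂)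
      (position j.1 + p)
    obtain ⟨i', hi'⟩ := exists_torusCongr_position (m₁ := n₁ + k₁) (m₂ := n₂ + k₂)
      (position j.1 - p)
    rw [hE, hext _ i (notMem_region_of_add hp j.2 hi) hi,
      hext _ i' (notMem_region_of_sub hp j.2 hi') hi']
    rw [hemb, sub_add_eq_add_sub, sub_right_comm]
  funext j
  rw [← hE j]
  exact key _ (hbox ▸ Finset.mem_map_of_mem emb (Finset.mem_univ j))

-- The coefficient matrix `B` is linear in the background, and over `ℝ` injectivity of `B` means
-- `det (Bᵀ B) ≠ 0`.
open Classical in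
theorem exists_polynomial_isDetermining
    (h : ∃ v : {p // p ∉ region n₁ n₂ k₁ k₂ a₁ a₂} → ℝ, IsDetermining v) :
    ∃ q : MvPolynomial {p // p ∉ region n₁ n₂ k₁ k₂ a₁ a₂} ℝ, q ≠ 0 ∧
      ∀ v, MvPolynomial.eval v q ≠ 0 → IsDetermining v := by
  obtain ⟨v₀, hv₀⟩ := h
  have hfin : (farShifts (n₁ + k₁ : ℕ) (n₂ + k₂ : ℕ) n₁ n₂).Finite := by
    refine (Finset.finite_toSet
      (Finset.Ico 0 ((n₁ + k₁ : ℕ) : ℤ) ×ˢ Finset.Ico 0 ((n₂ + k₂ : ℕ) : ℤ))).subset ?_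
    rintro p ⟨⟨h1, h2, h3, h4⟩, -⟩
    simp only [Finset.coe_product, Finset.coe_Ico, Set.mem_prod, Set.mem_Ico]
    exact ⟨⟨h1, h2⟩, h3, h4⟩
  have : Fintype (farShifts (n₁ + k₁ : ℕ) (n₂ + k₂ : ℕ) n₁ n₂) := hfin.fintype
  let c : ℤ × ℤ → {p // p ∉ region n₁ n₂ k₁ k₂ a₁ a₂} → ℝ := fun x i =>
    if TorusCongr (n₁ + k₁ : ℕ) (n₂ + k₂ : ℕ) x (position i.1) then 1 else 0
  let B : Matrix (farShifts (n₁ + k₁ : ℕ) (n₂ + k₂ : ℕ) n₁ n₂)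
      {p // p ∈ region n₁ n₂ k₁ k₂ a₁ a₂}
      (MvPolynomial {p // p ∉ region n₁ n₂ k₁ k₂ a₁ a₂} ℝ) :=
    Matrix.of fun p j => ∑ i, MvPolynomial.X i *
      MvPolynomial.C (c (position j.1 + p) i + c (position j.1 - p) i)
  have hdet : ∀ v, MvPolynomial.eval v (Bᵀ * B).det ≠ 0 ↔ IsDetermining v := by
    intro v
    rw [RingHom.map_det, RingHom.mapMatrix_apply, Matrix.map_mul, Matrix.transpose_map,
      det_transpose_mul_self_ne_zero_iff]
    refine forall_congr' fun W => imp_congr_left ?_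
    rw [funext_iff, Subtype.forall]
    refine forall₂_congr fun p hp => ?_
    simp only [Matrix.mulVec, dotProduct, Pi.zero_apply]
    refine Eq.congr_left (Finset.sum_congr rfl fun j _ => ?_)
    rw [mul_comm]
    congr 1
    simp only [B, Matrix.map_apply, Matrix.of_apply, map_sum, map_mul, MvPolynomial.eval_X,
      MvPolynomial.eval_C, periodicExtension, mul_add, Finset.sum_add_distrib, c]
  refine ⟨(Bᵀ * B).det, fun h0 => ?_, fun v => (hdet v).1⟩
  exact (hdet v₀).2 hv₀ (by rw [h0, map_zero])

theorem ae_isDetermining {Ω : Type*} [MeasurableSpace Ω] (P : Measure Ω) [IsProbabilityMeasure P]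
    {μ σ : ℝ} (hσ : 0 < σ) {Y : Ω → Matrix (Fin (n₁ + k₁)) (Fin (n₂ + k₂)) ℝ}
    (hY : IsGaussianBackground P μ σ a₁ a₂ Y)
    (h : ∃ v : {p // p ∉ region n₁ n₂ k₁ k₂ a₁ a₂} → ℝ, IsDetermining v) :
    ∀ᵐ ω ∂P, IsDetermining
      (fun p : {p // p ∉ region n₁ n₂ k₁ k₂ a₁ a₂} => Y ω p.1.1 p.1.2) := by
  classical
  obtain ⟨q, hq0, hq⟩ := exists_polynomial_isDetermining h
  have hmeas : ∀ p : {p // p ∉ region n₁ n₂ k₁ k₂ a₁ a₂},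
      AEMeasurable (fun ω => Y ω p.1.1 p.1.2) P := fun p => (hY.hasLaw p.1 p.2).aemeasurable
  have hmap := (iIndepFun_iff_map_fun_eq_pi_map hmeas).1 hY.indep
  obtain ⟨s, hs⟩ : ∃ s : NNReal, s = ⟨σ ^ 2, sq_nonneg σ⟩ := ⟨_, rfl⟩
  have hlaw : (fun p : {p // p ∉ region n₁ n₂ k₁ k₂ a₁ a₂} =>
      P.map fun ω => Y ω p.1.1 p.1.2) = fun _ => gaussianReal μ s := by
    rw [hs]
    exact funext fun p => (hY.hasLaw p.1 p.2).map_eq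
  rw [hlaw] at hmap
  have hne : s ≠ 0 := by
    rintro rfl
    exact (pow_pos hσ 2).ne (congrArg NNReal.toReal hs)
  have := nullSingletonClass_gaussianReal (μ := μ) hne
  have hae := ae_eval_ne_zero (gaussianReal μ s) hq0
  rw [← hmap] at hae
  filter_upwards [ae_of_ae_map (aemeasurable_pi_lambda _ hmeas) hae] with ω hω
  exact hq _ hω

theorem combine_apply_of_notMem (X : Matrix (Fin n₁) (Fin n₂) ℝ)
    (Y : Matrix (Fin (n₁ + k₁)) (Fin (n₂ + k₂)) ℝ) {p : Fin (n₁ + k₁) × Fin (n₂ + k₂)}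
    (hp : p ∉ region n₁ n₂ k₁ k₂ a₁ a₂) : combine a₁ a₂ X Y p.1 p.2 = Y p.1 p.2 :=
  dif_neg hp

theorem combine_injective (ha₁ : a₁ ≤ k₁) (ha₂ : a₂ ≤ k₂)
    {X X' : Matrix (Fin n₁) (Fin n₂) ℝ} {Y : Matrix (Fin (n₁ + k₁)) (Fin (n₂ + k₂)) ℝ}
    (h : combine a₁ a₂ X Y = combine a₁ a₂ X' Y) : X = X' := by
  ext i l
  have hp : ((⟨a₁ + i, by omega⟩, ⟨a₂ + l, by omega⟩) : Fin (n₁ + k₁) × Fin (n₂ + k₂)) ∈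
      region n₁ n₂ k₁ k₂ a₁ a₂ := by
    simp [region]
  have := congrFun (congrFun h ⟨a₁ + i, by omega⟩) ⟨a₂ + l, by omega⟩
  simpa [combine, hp] using this

-- The sum is the difference of the autocorrelations of the two arrays at `p`. In each product with
-- positions differing by `p`, at least one factor is a background entry, common to both arrays, so
-- the difference is linear in the change of signal.
open Classical in
theorem sum_mul_periodicExtension_eq_zero [NeZero (n₁ + k₁)] [NeZero (n₂ + k₂)]
    {X X' : Matrix (Fin n₁) (Fin n₂) ℝ} {Y : Matrix (Fin (n₁ + k₁)) (Fin (n₂ + k₂)) ℝ}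
    (h : intensity (combine a₁ a₂ X' Y) = intensity (combine a₁ a₂ X Y)) {p : ℤ × ℤ}
    (hp : p ∈ farShifts (n₁ + k₁ : ℕ) (n₂ + k₂ : ℕ) n₁ n₂) :
    ∑ j : {p // p ∈ region n₁ n₂ k₁ k₂ a₁ a₂},
      (combine a₁ a₂ X' Y j.1.1 j.1.2 - combine a₁ a₂ X Y j.1.1 j.1.2) *
        (periodicExtension (fun i : {p // p ∉ region n₁ n₂ k₁ k₂ a₁ a₂} => Y i.1.1 i.1.2)
          (position j.1 + p) +
        periodicExtension (fun i : {p // p ∉ region n₁ n₂ k₁ k₂ a₁ a₂} => Y i.1.1 i.1.2)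
          (position j.1 - p)) = 0 := by
  set Z' := combine a₁ a₂ X' Y with hZ'
  set Z := combine a₁ a₂ X Y with hZ
  let w : Fin (n₁ + k₁) × Fin (n₂ + k₂) → ℝ := fun s => Z' s.1 s.2 - Z s.1 s.2
  let V : Fin (n₁ + k₁) × Fin (n₂ + k₂) → ℝ := fun s =>
    if s ∈ region n₁ n₂ k₁ k₂ a₁ a₂ then 0 else Y s.1 s.2
  let c : ℤ × ℤ → Fin (n₁ + k₁) × Fin (n₂ + k₂) → ℝ := fun x s =>
    if TorusCongr (n₁ + k₁ : ℕ) (n₂ + k₂ : ℕ) x (position s) then 1 else 0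
  have hw : ∀ s ∉ region n₁ n₂ k₁ k₂ a₁ a₂, w s = 0 := fun s hs => by
    simp only [w, hZ, hZ', combine_apply_of_notMem _ _ hs, sub_self]
  have hext : ∀ x, periodicExtension
      (fun i : {p // p ∉ region n₁ n₂ k₁ k₂ a₁ a₂} => Y i.1.1 i.1.2) x = ∑ s, V s * c x s := by
    intro x
    rw [← Fintype.sum_subtype_add_sum_subtype (· ∈ region n₁ n₂ k₁ k₂ a₁ a₂),
      Finset.sum_eq_zero, zero_add, periodicExtension]
    · exact Finset.sum_congr rfl fun i _ => by simp only [V, if_neg i.2, c]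
    · exact fun i _ => by simp only [V, if_pos i.2, zero_mul]
  have hsum : ∀ g : Fin (n₁ + k₁) × Fin (n₂ + k₂) → ℝ,
      ∑ j : {p // p ∈ region n₁ n₂ k₁ k₂ a₁ a₂}, w j.1 * g j.1 = ∑ s, w s * g s := by
    intro g
    rw [← Fintype.sum_subtype_add_sum_subtype (· ∈ region n₁ n₂ k₁ k₂ a₁ a₂) fun s => w s * g s,
      left_eq_add]
    exact Finset.sum_eq_zero fun i _ => by rw [hw _ i.2, zero_mul]
  have hauto := autocorrelation_eq_of_intensity_eq h p
  calc _ = ∑ s, w s * (∑ s', V s' * c (position s + p) s' + ∑ s', V s' * c (position s - p) s') := by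
        rw [← hsum]
        exact Finset.sum_congr rfl fun j _ => by rw [hext, hext]
    _ = ∑ s, ∑ s', (w s * V s' + V s * w s') * c (position s' + p) s := by
        simp only [mul_add, add_mul, Finset.sum_add_distrib, Finset.mul_sum]
        rw [add_comm]
        congr 1
        · refine Finset.sum_congr rfl fun s _ => Finset.sum_congr rfl fun s' _ => ?_
          simp only [c, torusCongr_sub_iff]
          ring
        · rw [Finset.sum_comm]
          exact Finset.sum_congr rfl fun s _ => Finset.sum_congr rfl fun s' _ => by ring
    _ = autocorrelation Z' p - autocorrelation Z p := by
        simp only [autocorrelation, ← Finset.sum_sub_distrib]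
        refine Finset.sum_congr rfl fun s _ => Finset.sum_congr rfl fun s' _ => ?_
        rw [← sub_mul]
        by_cases hc : TorusCongr (n₁ + k₁ : ℕ) (n₂ + k₂ : ℕ) (position s' + p) (position s)
        swap
        · simp only [c, if_neg hc, mul_zero]
        simp only [c, if_pos hc, mul_one]
        have hZs : ∀ s ∉ region n₁ n₂ k₁ k₂ a₁ a₂, Z s.1 s.2 = V s ∧ Z' s.1 s.2 = V s := by
          intro s hs
          simp only [V, if_neg hs, hZ, hZ', combine_apply_of_notMem _ _ hs, and_self]
        by_cases hs : s ∈ region n₁ n₂ k₁ k₂ a₁ a₂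
        · have hs' : s' ∉ region n₁ n₂ k₁ k₂ a₁ a₂ := fun hs' => notMem_region_of_add hp hs' hc hs
          rw [hw s' hs', (hZs s' hs').1, (hZs s' hs').2]
          simp only [w]
          ring
        · rw [hw s hs, (hZs s hs).1, (hZs s hs).2]
          simp only [w]
          ring
    _ = 0 := by rw [hauto, sub_self]

theorem ExactlyUnique.of_eq_of_intensity_eq
    {Y : Matrix (Fin (n₁ + k₁)) (Fin (n₂ + k₂)) ℝ}
    (h : ∀ X X' : Matrix (Fin n₁) (Fin n₂) ℝ,
      intensity (combine a₁ a₂ X' Y) = intensity (combine a₁ a₂ X Y) → X' = X) :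
    ExactlyUnique a₁ a₂ Y := by
  refine fun X => ⟨fun Z => ⟨?_, ?_⟩, fun X' => h X X'⟩
  · rintro ⟨hI, X', rfl⟩
    rw [h X X' hI]
  · rintro rfl
    exact ⟨rfl, X, rfl⟩

theorem IsDetermining.exactlyUnique [NeZero (n₁ + k₁)] [NeZero (n₂ + k₂)] (ha₁ : a₁ ≤ k₁)
    (ha₂ : a₂ ≤ k₂) {Y : Matrix (Fin (n₁ + k₁)) (Fin (n₂ + k₂)) ℝ}
    (hY : IsDetermining (fun p : {p // p ∉ region n₁ n₂ k₁ k₂ a₁ a₂} => Y p.1.1 p.1.2)) :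
    ExactlyUnique a₁ a₂ Y := by
  refine ExactlyUnique.of_eq_of_intensity_eq fun X X' h => combine_injective ha₁ ha₂ (Y := Y) ?_
  have hW := hY _ fun p hp => sum_mul_periodicExtension_eq_zero h hp
  ext i l
  by_cases hp : (i, l) ∈ region n₁ n₂ k₁ k₂ a₁ a₂
  · exact sub_eq_zero.1 (congrFun hW ⟨(i, l), hp⟩)
  · rw [combine_apply_of_notMem X' Y hp, combine_apply_of_notMem X Y hp]

theorem ae_exactlyUnique {Ω : Type*} [MeasurableSpace Ω] (P : Measure Ω) [IsProbabilityMeasure P]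
    {μ σ : ℝ} (hσ : 0 < σ) (ha₁ : a₁ ≤ k₁) (ha₂ : a₂ ≤ k₂)
    {Y : Ω → Matrix (Fin (n₁ + k₁)) (Fin (n₂ + k₂)) ℝ}
    (hY : IsGaussianBackground P μ σ a₁ a₂ Y)
    (h : (2 * (n₁ : ℤ) - 1) * (3 * (n₂ : ℤ) - 1) + (n₂ : ℤ)
          ≤ ((n₁ : ℤ) + (k₁ : ℤ)) * ((n₂ : ℤ) + (k₂ : ℤ))) :
    ∀ᵐ ω ∂P, ExactlyUnique a₁ a₂ (Y ω) := by
  -- With an empty block there is only one signal.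
  obtain rfl | hn₁ := Nat.eq_zero_or_pos n₁
  · exact Filter.Eventually.of_forall fun ω =>
      ExactlyUnique.of_eq_of_intensity_eq fun X X' _ => Subsingleton.elim X' X
  obtain rfl | hn₂ := Nat.eq_zero_or_pos n₂
  · exact Filter.Eventually.of_forall fun ω =>
      ExactlyUnique.of_eq_of_intensity_eq fun X X' _ => Subsingleton.elim X' X
  have : NeZero (n₁ + k₁) := ⟨by omega⟩
  have : NeZero (n₂ + k₂) := ⟨by omega⟩
  filter_upwards [ae_isDetermining P hσ hY (exists_isDetermining hn₁ hn₂ ha₁ ha₂ h)] with ω hω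
  exact hω.exactlyUnique ha₁ ha₂

/-- For `n ≥ 1`, `(n + k)² ≥ 6n² ≥ 6n² - 4n + 1`. The alternative is needed because the count fails
for `n = k = 0`. -/
theorem count_le_of_sqrt_six_mul_le {n k : ℕ} (h : (Real.sqrt 6 - 1) * (n : ℝ) ≤ (k : ℝ)) :
    (2 * (n : ℤ) - 1) * (3 * (n : ℤ) - 1) + (n : ℤ) ≤
      ((n : ℤ) + (k : ℤ)) * ((n : ℤ) + (k : ℤ)) ∨ n = 0 := by
  obtain rfl | hn := Nat.eq_zero_or_pos n
  · exact Or.inr rfl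
  left
  have hn' : (1 : ℝ) ≤ n := by exact_mod_cast hn
  have h1 : Real.sqrt 6 * n ≤ n + k := by linarith
  have h2 : (Real.sqrt 6 * n) ^ 2 ≤ ((n : ℝ) + k) ^ 2 :=
    pow_le_pow_left₀ (by positivity) h1 2
  rw [mul_pow, Real.sq_sqrt (by norm_num)] at h2
  have h3 : (2 * (n : ℝ) - 1) * (3 * n - 1) + n ≤ (n + k) * (n + k) := by nlinarith
  exact_mod_cast h3

end PhaseRetrieval

theorem theorem2p1 {Ω : Type*} [MeasurableSpace Ω] (P : Measure Ω) [IsProbabilityMeasure P]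
    (μ σ : ℝ) (hσ : 0 < σ) :
    (∀ (n₁ n₂ k₁ k₂ a₁ a₂ : ℕ), a₁ ≤ k₁ → a₂ ≤ k₂ →
      ∀ Y : Ω → Matrix (Fin (n₁ + k₁)) (Fin (n₂ + k₂)) ℝ,
        PhaseRetrieval.IsGaussianBackground P μ σ a₁ a₂ Y →
        (2 * (n₁ : ℤ) - 1) * (3 * (n₂ : ℤ) - 1) + (n₂ : ℤ)
          ≤ ((n₁ : ℤ) + (k₁ : ℤ)) * ((n₂ : ℤ) + (k₂ : ℤ)) →
        ∀ᵐ ω ∂P, PhaseRetrieval.ExactlyUnique a₁ a₂ (Y ω)) ∧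
    (∀ (n k a₁ a₂ : ℕ), a₁ ≤ k → a₂ ≤ k →
      ∀ Y : Ω → Matrix (Fin (n + k)) (Fin (n + k)) ℝ,
        PhaseRetrieval.IsGaussianBackground P μ σ a₁ a₂ Y →
        (Real.sqrt 6 - 1) * (n : ℝ) ≤ (k : ℝ) →
        ∀ᵐ ω ∂P, PhaseRetrieval.ExactlyUnique a₁ a₂ (Y ω)) := by
  refine ⟨fun n₁ n₂ k₁ k₂ a₁ a₂ ha₁ ha₂ Y hY h =>
    PhaseRetrieval.ae_exactlyUnique P hσ ha₁ ha₂ hY h, fun n k a₁ a₂ ha₁ ha₂ Y hY h => ?_⟩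
  obtain h | rfl := PhaseRetrieval.count_le_of_sqrt_six_mul_le h
  · exact PhaseRetrieval.ae_exactlyUnique P hσ ha₁ ha₂ hY h
  · exact Filter.Eventually.of_forall fun ω =>
      PhaseRetrieval.ExactlyUnique.of_eq_of_intensity_eq fun X X' _ => Subsingleton.elim X' X
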